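/- **Model.** Let $M=[m]$ be a set of $m$ indivisible items and let there be $n$ players. A (general) valuation is a function $v:2^M\to\mathbb R_{\ge 0}$ that is monotone ($S\subseteq T$ implies $v(S)\le v(T)$), with $v(\emptyset)=0$ and $v(M)>0$. An allocation is an ordered partition $(A_1,\dots,A_n)$ of $M$ (empty bundles allowed); for $c\in[0,1]$ it is $c$-Prop if $v_i(A_i)\ge c\cdot v_i(M)/n$ for every player $i$. Player $i$ knows only $v_i$. In a deterministic protocol the bits sent so far determine which player acts next and whether she broadcasts one bit or ends the protocol by declaring an answer; the bit or the answer is a function of her own valuation and of the bits sent so far. A public-coin randomized protocol may in addition depend on an infinite stream of independent fair random bits per player, all of them seen by all players (the answer on each input being a random variable). Its communication cost is the number of bits sent (the final declaration is not counted) in the worst case over valuations and random bits. It *determines whether a $c$-Prop allocation exists* if for every valuation profile it declares the correct yes/no answer with probability at least $2/3$. $R(n,m,\mathrm{Prop},c)$ is the minimum cost of a randomized protocol that, for every valuation profile, with probability at least $2/3$ declares a $c$-Prop allocation if one exists and declares that there is none otherwise. **Theorem.** There is a constant $\delta>0$ such that for all $c\in(0,1]$ and all integers $k\ge 1$: every randomized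 protocol that determines, for two players with general valuations on $2k$ items, whether a $c$-Prop allocation exists has communication cost at least $\delta\binom{2k}{k}$; and also $$R(2,2k,\mathrm{Prop},c)\ \ge\ \delta\binom{2k}{k}.$$ In particular, $R(2,2k,\mathrm{Prop},c)\in\Omega\big(\binom{2k}{k}\big)$ for every $c\in(0,1]$. With the same $\delta$, both bounds remain true for protocols that only have to handle valuations all of whose values lie in a prescribed set $D\subseteq\mathbb R_{\ge0}$ with $0,1\in D$ (for instance, the integers of at most $b$ bits, for any $b\ge1$). -/

import Mathlib

open MeasureTheory
open scoped NNReal ENNReal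

namespace FairDivision

/-- A general valuation on the items `Fin m`: a monotone, normalized function on bundles giving
positive value to the set of all items. All values lie in the set `D` of representable values;
`D = Set.univ` imposes no restriction. -/
structure Valuation (m : ℕ) (D : Set ℝ≥0) where
  val : Finset (Fin m) → ℝ≥0
  mono : ∀ ⦃S T : Finset (Fin m)⦄, S ⊆ T → val S ≤ val T
  val_empty : val ∅ = 0
  val_univ_pos : 0 < val Finset.univ
  mem_values : ∀ S, val S ∈ D

/-- A valuation profile: one valuation for each of the `n` players. -/
abbrev Profile (n m : ℕ) (D : Set ℝ≥0) : Type := Fin n → Valuation m D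

/-- An allocation of the items `Fin m` to the players `Fin n`, given by the owner of each item. -/
abbrev Allocation (n m : ℕ) : Type := Fin m → Fin n

/-- The bundle that player `i` receives. -/
def Allocation.bundle {n m : ℕ} (A : Allocation n m) (i : Fin n) : Finset (Fin m) :=
  Finset.univ.filter (fun g => A g = i)

/-- `A` is `c`-Prop: `v_i(A_i) ≥ c * v_i(M) / n` for each player `i`. -/
def IsProp {n m : ℕ} {D : Set ℝ≥0} (c : ℝ) (v : Profile n m D) (A : Allocation n m) : Prop :=
  ∀ i : Fin n, c * (((v i).val Finset.univ : ℝ) / (n : ℝ)) ≤ ((v i).val (A.bundle i) : ℝ)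

/-- Deterministic protocols for players `Fin n` with private inputs in `X` and answers in `O`.
At `speak i msg next`, player `i` broadcasts the bit `msg x`, where `x` is her private input, and the
protocol goes on with `next` of that bit. At `declare i ans`, player `i` ends the protocol by
declaring the answer `ans x`. So who acts, and what she does as a function of her own input, is
determined by the bits sent so far. -/
inductive Protocol (n : ℕ) (X O : Type) : Type
  | declare (i : Fin n) (ans : X → O) : Protocol n X O
  | speak (i : Fin n) (msg : X → Bool) (next : Bool → Protocol n X O) : Protocol n X O

namespace Protocol

variable {n : ℕ} {X O : Type}

/-- The answer declared on the input profile `x`. -/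
def answer : Protocol n X O → (Fin n → X) → O
  | declare i ans, x => ans (x i)
  | speak i msg next, x => answer (next (msg (x i))) x

/-- The number of bits sent on the input profile `x`; the final declaration is not counted. -/
def bits : Protocol n X O → (Fin n → X) → ℕ
  | declare _ _, _ => 0
  | speak i msg next, x => bits (next (msg (x i))) x + 1

end Protocol

/-- The random bits: an infinite stream for each player. -/
abbrev Coins (n : ℕ) : Type := Fin n × ℕ → Bool

/-- The law of the random bits: independent fair coins. -/
noncomputable def coinMeasure (n : ℕ) : Measure (Coins n) :=
  Measure.infinitePi (fun _ : Fin n × ℕ => (PMF.uniformOfFintype Bool).toMeasure)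

/-- Public-coin randomized protocols: all players see all random bits, and once these are fixed
the protocol is deterministic. The answer on each input is required to be a random variable. -/
structure RandomizedProtocol (n : ℕ) (X O : Type) where
  run : Coins n → Protocol n X O
  measurableSet_answer : ∀ (x : Fin n → X) (o : O), MeasurableSet {ω | (run ω).answer x = o}

namespace RandomizedProtocol

variable {n : ℕ} {X O : Type}

/-- The communication cost: the number of bits sent in the worst case over inputs and coins. -/
noncomputable def cost (Γ : RandomizedProtocol n X O) : ℕ∞ :=
  ⨆ (x : Fin n → X) (ω : Coins n), ((Γ.run ω).bits x : ℕ∞)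

/-- On every input the answer is right (in the sense of `right`) with probability at least 2/3. -/
def Computes (Γ : RandomizedProtocol n X O) (right : (Fin n → X) → O → Prop) : Prop :=
  ∀ x : Fin n → X, (2 / 3 : ℝ≥0∞) ≤ coinMeasure n {ω | right x ((Γ.run ω).answer x)}

end RandomizedProtocol

/-- The right answers to the question whether there is a `c`-Prop allocation. -/
def RightDecision {n m : ℕ} {D : Set ℝ≥0} (c : ℝ) (v : Profile n m D) (b : Bool) : Prop :=
  b = true ↔ ∃ A, IsProp c v A

/-- The right answers to the search problem: a `c`-Prop allocation, or `none` if there is none. -/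
def RightSearch {n m : ℕ} {D : Set ℝ≥0} (c : ℝ) (v : Profile n m D) :
    Option (Allocation n m) → Prop
  | some A => IsProp c v A
  | none => ∀ A, ¬ IsProp c v A

/-- The randomized communication complexity `R(n, m, Prop, c)`: the least cost of a randomized
protocol that finds a `c`-Prop allocation or shows that there is none, for `n` players and `m`
items, with valuations whose values lie in `D`. -/
noncomputable def randomizedComplexity (D : Set ℝ≥0) (n m : ℕ) (c : ℝ) : ℕ∞ :=
  ⨅ (Γ : RandomizedProtocol n (Valuation m D) (Option (Allocation n m)))
    (_ : Γ.Computes (RightSearch c)), Γ.cost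

end FairDivision

/-! The problem contains set disjointness on `(2k).choose k` points. Take 0-1 valuations that accept
all bundles of more than k items and none of fewer; which bundles of exactly k items are accepted is
free. An allocation acceptable to both players must then split the items evenly, so it exists iff
the half bundles accepted by the first player meet the complements of those accepted by the second.

Disjointness needs linear communication. Split the coordinates at random by `d`: those in `d` are
random bits for the first player and zero for the second, the others vice versa. The leaves of a
protocol are rectangles, and by the level-one inequality (`sum_sq_div_le_log_card`) the squared
biases of all coordinates given the leaf add up to at most twice the logarithm of the number of
leaves. If there are few leaves, then at a typical coordinate the law of the leaf hardly changes, in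
Hellinger distance, when the two players' bits go from (0,0) to (1,0) or to (0,1). Hence (1,0) and
(0,1) look alike, and by cut-and-paste (`sum_hellinger_cut_paste`) so do (0,0) and (1,1), which a
correct protocol must tell apart (`sq_advantage_le_leafBias`). Averaging fixes the coins
(`Computes.exists_run`). -/

namespace Disjointness

open Finset Function Real
open scoped BigOperators

/-! ### Inequalities on the cube and for finite distributions. -/

variable {ι L : Type*} [Fintype ι] [DecidableEq ι] [Fintype L] [DecidableEq L]

/-- The sign attached to a bit. -/
def sgn (b : Bool) : ℝ := bif b then 1 else -1

@[simp] lemma sgn_true : sgn true = 1 := rfl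
@[simp] lemma sgn_false : sgn false = -1 := rfl

/-- Averaging over the cube can be done after resampling one coordinate. -/
lemma expect_eq_expect_update (i : ι) (f : (ι → Bool) → ℝ) :
    𝔼 u, f u = (𝔼 u, f (update u i true) + 𝔼 u, f (update u i false)) / 2 := by
  have hflip : 𝔼 u : ι → Bool, f (update u i (!u i)) = 𝔼 u, f u := by
    have hinv : Involutive (fun u : ι → Bool => update u i (!u i)) := by
      intro u
      ext j
      by_cases h : j = i
      · subst h; simp
      · simp [h]
    exact Fintype.expect_equiv hinv.toPerm _ _ fun _ => rfl
  have hsum : 𝔼 u, f (update u i true) + 𝔼 u, f (update u i false)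
      = 𝔼 u, f u + 𝔼 u : ι → Bool, f (update u i (!u i)) := by
    rw [← expect_add_distrib, ← expect_add_distrib]
    refine expect_congr rfl fun u _ => ?_
    have hu : update u i (u i) = u := update_eq_self i u
    cases h : u i <;> rw [h] at hu <;> simp [hu, add_comm]
  rw [hsum, hflip]
  ring

/-- Sums of independent signs are sub-Gaussian. -/
lemma expect_exp_sum_sgn_le (w : ι → ℝ) :
    𝔼 u : ι → Bool, exp (∑ i, w i * sgn (u i)) ≤ exp (∑ i, w i ^ 2 / 2) := by
  have hprod : ∑ u : ι → Bool, exp (∑ i, w i * sgn (u i)) = ∏ i, (2 * cosh (w i)) := by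
    have h := Fintype.prod_sum (fun (i : ι) (b : Bool) => exp (w i * sgn b))
    simp only [exp_sum]
    rw [← h]
    refine prod_congr rfl fun i _ => ?_
    rw [Fintype.sum_bool, cosh_eq]
    simp
    ring
  rw [Fintype.expect_eq_sum_div_card, hprod, prod_mul_distrib, exp_sum]
  simp only [prod_const, card_univ, Fintype.card_fun, Fintype.card_bool, Nat.cast_pow,
    Nat.cast_ofNat]
  rw [mul_div_cancel_left₀ _ (by positivity)]
  exact prod_le_prod (fun i _ => (cosh_pos _).le) fun i _ => cosh_le_exp_half_sq _

/-- Jensen's inequality for the exponential function. -/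
lemma exp_expect_le {Ω : Type*} [Fintype Ω] [Nonempty Ω] (f : Ω → ℝ) :
    exp (𝔼 ω, f ω) ≤ 𝔼 ω, exp (f ω) := by
  set c := 𝔼 ω, f ω with hc
  -- The graph of exp lies above its tangent at the mean `c`.
  have h : 𝔼 ω, exp c * (1 + (f ω - c)) ≤ 𝔼 ω, exp (f ω) := by
    refine expect_le_expect fun ω _ => ?_
    have h1 := add_one_le_exp (f ω - c)
    calc exp c * (1 + (f ω - c)) ≤ exp c * exp (f ω - c) := by
          gcongr; linarith
      _ = exp (f ω) := by rw [← exp_add]; congr 1; ring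
  rw [← mul_expect, expect_add_distrib, expect_sub_distrib, Fintype.expect_const,
    Fintype.expect_const, ← hc] at h
  simpa using h

omit [DecidableEq ι] in
/-- The level-one inequality, averaged over the parts of a partition into few parts. -/
lemma sum_sq_div_le_log_card {Ω : Type*} [Fintype Ω] [Nonempty Ω] (χ : ι → Ω → ℝ)
    (hχ : ∀ w : ι → ℝ, 𝔼 ω, exp (∑ i, w i * χ i ω) ≤ exp (∑ i, w i ^ 2 / 2)) (g : Ω → L) :
    ∑ i, ∑ l, (𝔼 ω, if g ω = l then χ i ω else 0) ^ 2 / (𝔼 ω, if g ω = l then (1 : ℝ) else 0)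
      ≤ 2 * log (Fintype.card L) := by
  set s : ι → L → ℝ := fun i l => 𝔼 ω, if g ω = l then χ i ω else 0 with hs
  set p : L → ℝ := fun l => 𝔼 ω, if g ω = l then (1 : ℝ) else 0 with hp
  change ∑ i, ∑ l, s i l ^ 2 / p l ≤ _
  -- The conditional mean of `χ i` on part `l`; it maximizes `w * s i l - w ^ 2 / 2 * p l`.
  set w : L → ι → ℝ := fun l i => s i l / p l with hw
  set W : L → Ω → ℝ := fun l ω => ∑ i, w l i * χ i ω - ∑ i, w l i ^ 2 / 2 with hW
  have hmean : 𝔼 ω, W (g ω) ω = (∑ i, ∑ l, s i l ^ 2 / p l) / 2 := by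
    have h1 : ∀ ω, W (g ω) ω = ∑ l, ∑ i, (w l i * (if g ω = l then χ i ω else 0)
        - w l i ^ 2 / 2 * (if g ω = l then (1 : ℝ) else 0)) := by
      intro ω
      rw [Fintype.sum_eq_single (g ω)]
      · simp [hW, sum_sub_distrib]
      · intro l hl
        simp [hl.symm]
    simp only [h1]
    rw [sum_comm, expect_sum_comm, sum_div]
    refine sum_congr rfl fun l _ => ?_
    rw [expect_sum_comm, sum_div]
    refine sum_congr rfl fun i _ => ?_
    rw [expect_sub_distrib, ← mul_expect, ← mul_expect]
    change w l i * s i l - w l i ^ 2 / 2 * p l = _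
    simp only [hw]
    -- On a null part both sides vanish, since division by zero gives zero.
    by_cases hpl : p l = 0
    · simp [hpl]
    · field_simp
      ring
  -- The term of the actual part is at most the sum over all parts, and each `exp (W l ω)` has mean
  -- at most 1 by `hχ`.
  have hbound : 𝔼 ω, exp (W (g ω) ω) ≤ Fintype.card L := by
    calc 𝔼 ω, exp (W (g ω) ω) ≤ 𝔼 ω, ∑ l, exp (W l ω) := by
          refine expect_le_expect fun ω _ => ?_
          exact single_le_sum (f := fun l => exp (W l ω)) (fun l _ => (exp_pos _).le)
            (mem_univ (g ω))
      _ = ∑ l, 𝔼 ω, exp (W l ω) := expect_sum_comm _ _ _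
      _ ≤ ∑ _l : L, 1 := by
          refine sum_le_sum fun l _ => ?_
          simp only [hW, exp_sub, ← expect_div]
          exact (div_le_one (exp_pos _)).2 (hχ _)
      _ = Fintype.card L := by simp
  have h := (exp_expect_le fun ω => W (g ω) ω).trans hbound
  rw [hmean] at h
  have hL : (0 : ℝ) < Fintype.card L := (exp_pos _).trans_le h
  have := (le_log_iff_exp_le hL).2 h
  linarith

/-- Factor p - q = (√p - √q)(√p + √q) and use (√p + √q)² ≥ p + q. This turns the bias of a
coordinate on a leaf into a Hellinger term. -/
lemma sq_sqrt_sub_sqrt_le {p q : ℝ} (hp : 0 ≤ p) (hq : 0 ≤ q) :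
    (√p - √q) ^ 2 / 2 ≤ ((p - q) / 2) ^ 2 / ((p + q) / 2) := by
  rcases (add_nonneg hp hq).eq_or_lt with h | h
  · have hp0 : p = 0 := by linarith
    have hq0 : q = 0 := by linarith
    simp [hp0, hq0]
  · rw [le_div_iff₀ (by linarith)]
    have h1 := sq_sqrt hp
    have h2 := sq_sqrt hq
    have h3 := sqrt_nonneg p
    have h4 := sqrt_nonneg q
    set a := √p
    set b := √q
    rw [← h1, ← h2]
    nlinarith [mul_nonneg (sq_nonneg (a - b)) (mul_nonneg h3 h4)]

omit [DecidableEq L] in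
/-- Distinguishing two distributions by a bounded test bounds their Hellinger distance. -/
lemma sq_sum_mul_sub_le (P Q t : L → ℝ) (hP : ∀ l, 0 ≤ P l) (hQ : ∀ l, 0 ≤ Q l)
    (hP1 : ∑ l, P l = 1) (hQ1 : ∑ l, Q l = 1) (ht : ∀ l, |t l| ≤ 1) :
    (∑ l, t l * (P l - Q l)) ^ 2 ≤ 4 * ∑ l, (√(P l) - √(Q l)) ^ 2 := by
  -- Prepares Cauchy–Schwarz; the 4 comes from (√P + √Q)² ≤ 2P + 2Q.
  have h1 : ∑ l, t l * (P l - Q l)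
      = ∑ l, (√(P l) - √(Q l)) * (t l * (√(P l) + √(Q l))) := by
    refine sum_congr rfl fun l _ => ?_
    have h2 := mul_self_sqrt (hP l)
    have h3 := mul_self_sqrt (hQ l)
    linear_combination t l * (h3 - h2)
  have h4 : ∑ l, (t l * (√(P l) + √(Q l))) ^ 2 ≤ 4 := by
    calc ∑ l, (t l * (√(P l) + √(Q l))) ^ 2 ≤ ∑ l, (2 * P l + 2 * Q l) := by
          refine sum_le_sum fun l _ => ?_
          have h2 := sq_sqrt (hP l)
          have h3 := sq_sqrt (hQ l)
          have h5 : t l ^ 2 ≤ 1 := (sq_le_one_iff_abs_le_one _).2 (ht l)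
          rw [mul_pow]
          nlinarith [sq_nonneg (√(P l) + √(Q l)), sq_nonneg (√(P l) - √(Q l))]
      _ = 4 := by rw [sum_add_distrib, ← mul_sum, ← mul_sum, hP1, hQ1]; norm_num
  rw [h1]
  refine (sum_mul_sq_le_sq_mul_sq _ _ _).trans ?_
  rw [mul_comm]
  gcongr

omit [DecidableEq L] in
/-- The cut-and-paste property of product distributions, for the Hellinger distance. -/
lemma sum_hellinger_cut_paste (a b : Bool → L → ℝ) (ha : ∀ c l, 0 ≤ a c l)
    (hb : ∀ c l, 0 ≤ b c l) (h1 : ∀ c e, ∑ l, a c l * b e l = 1) :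
    ∑ l, (√(a false l * b false l) - √(a true l * b true l)) ^ 2
      = ∑ l, (√(a true l * b false l) - √(a false l * b true l)) ^ 2 := by
  -- The distance depends only on the products `P l * Q l`, and both pairs have the same four
  -- factors.
  have key : ∀ P Q : L → ℝ, (∀ l, 0 ≤ P l) → (∀ l, 0 ≤ Q l) → ∑ l, P l = 1 → ∑ l, Q l = 1 →
      ∑ l, (√(P l) - √(Q l)) ^ 2 = 2 - 2 * ∑ l, √(P l * Q l) := by
    intro P Q hP hQ hP1 hQ1
    have : (2 : ℝ) - 2 * ∑ l, √(P l * Q l) = ∑ l, P l + ∑ l, Q l - 2 * ∑ l, √(P l * Q l) := by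
      rw [hP1, hQ1]; norm_num
    rw [this, mul_sum, ← sum_add_distrib, ← sum_sub_distrib]
    refine sum_congr rfl fun l _ => ?_
    rw [sqrt_mul (hP l), sub_sq, sq_sqrt (hP l), sq_sqrt (hQ l)]
    ring
  rw [key _ _ (fun l => mul_nonneg (ha _ _) (hb _ _)) (fun l => mul_nonneg (ha _ _) (hb _ _))
      (h1 _ _) (h1 _ _),
    key _ _ (fun l => mul_nonneg (ha _ _) (hb _ _)) (fun l => mul_nonneg (ha _ _) (hb _ _))
      (h1 _ _) (h1 _ _)]
  congr 2
  refine sum_congr rfl fun l _ => ?_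
  congr 1
  ring

end Disjointness

/-! ### The information bound for disjointness. -/

namespace Disjointness

open Finset Function Real
open scoped BigOperators

variable {ι L : Type*} [Fintype ι] [DecidableEq ι] [Fintype L] [DecidableEq L]

/-- The restriction of `u` to the set `d`. -/
def mask (d u : ι → Bool) : ι → Bool := fun j => d j && u j

omit [Fintype ι] in
lemma update_mask_update (d u : ι → Bool) (i : ι) (b c : Bool) :
    update (mask (update d i b) u) i c = update (mask d u) i c := by
  ext j
  by_cases h : j = i
  · subst h; simp
  · simp [h, mask]

lemma expect_mask_of_mem (d : ι → Bool) (i : ι) (hi : d i = true) (F : (ι → Bool) → ℝ) :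
    𝔼 u, F (mask d u) =
      (𝔼 u, F (update (mask d u) i true) + 𝔼 u, F (update (mask d u) i false)) / 2 := by
  have h : ∀ u c, mask d (update u i c) = update (mask d u) i c := by
    intro u c
    ext j
    by_cases h : j = i
    · subst h; simp [mask, hi]
    · simp [h, mask]
  rw [expect_eq_expect_update i]
  simp only [h]

lemma expect_sgn_mul_mask_of_mem (d : ι → Bool) (i : ι) (hi : d i = true)
    (F : (ι → Bool) → ℝ) :
    𝔼 u, sgn (u i) * F (mask d u) =
      (𝔼 u, F (update (mask d u) i true) - 𝔼 u, F (update (mask d u) i false)) / 2 := by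
  have h : ∀ u c, mask d (update u i c) = update (mask d u) i c := by
    intro u c
    ext j
    by_cases h : j = i
    · subst h; simp [mask, hi]
    · simp [h, mask]
  rw [expect_eq_expect_update i]
  simp only [h, update_self, sgn_true, sgn_false, one_mul, neg_one_mul, expect_neg_distrib]
  ring

lemma expect_mask_of_notMem (d : ι → Bool) (i : ι) (hi : d i = false) (F : (ι → Bool) → ℝ) :
    𝔼 u, F (mask d u) = 𝔼 u, F (update (mask d u) i false) := by
  refine expect_congr rfl fun u _ => ?_
  congr 1
  ext j
  by_cases h : j = i
  · subst h; simp [mask, hi]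
  · simp [h]

omit [DecidableEq ι] [Fintype ι] in
lemma expect_prod_mul {α β : Type*} [Fintype α] [Fintype β] (F : α → ℝ) (G : β → ℝ) :
    𝔼 ω : α × β, F ω.1 * G ω.2 = (𝔼 u, F u) * 𝔼 v, G v := by
  rw [← univ_product_univ, expect_product, expect_mul_expect]

/-- Each coordinate takes its sign from only one of two independent cubes, so the expectation
factors into two sub-Gaussian ones. -/
lemma expect_exp_sum_sgn_choice_le (d : ι → Bool) (w : ι → ℝ) :
    𝔼 ω : (ι → Bool) × (ι → Bool),
        exp (∑ i, w i * (if d i = true then sgn (ω.1 i) else sgn (ω.2 i)))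
      ≤ exp (∑ i, w i ^ 2 / 2) := by
  have h : ∀ ω : (ι → Bool) × (ι → Bool),
      exp (∑ i, w i * (if d i = true then sgn (ω.1 i) else sgn (ω.2 i)))
        = exp (∑ i, (if d i = true then w i else 0) * sgn (ω.1 i))
          * exp (∑ i, (if d i = true then 0 else w i) * sgn (ω.2 i)) := by
    intro ω
    rw [← exp_add, ← sum_add_distrib]
    congr 1
    refine sum_congr rfl fun i _ => ?_
    split_ifs <;> simp
  simp only [h]
  rw [expect_prod_mul
    (fun u : ι → Bool => exp (∑ i, (if d i = true then w i else 0) * sgn (u i)))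
    (fun v : ι → Bool => exp (∑ i, (if d i = true then 0 else w i) * sgn (v i)))]
  refine (mul_le_mul (expect_exp_sum_sgn_le _) (expect_exp_sum_sgn_le _)
    (expect_nonneg fun _ _ => (exp_pos _).le) (exp_pos _).le).trans ?_
  rw [← exp_add, ← sum_add_distrib]
  refine exp_le_exp.2 (sum_le_sum fun i _ => ?_)
  split_ifs <;> simp

section Core

variable (g : (ι → Bool) → (ι → Bool) → L) (A B : L → (ι → Bool) → ℝ)

/-- The average of `F` over the inputs supported in `d`, with coordinate `i` fixed to `c`. -/
noncomputable def slice (F : L → (ι → Bool) → ℝ) (i : ι) (d : ι → Bool) (c : Bool) (l : L) : ℝ :=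
  𝔼 u, F l (update (mask d u) i c)

-- Coordinate `i` is overwritten anyway. Hence the two splits that differ only at `i` can be
-- compared through the same slices.
omit [Fintype L] [DecidableEq L] in
lemma slice_update (F : L → (ι → Bool) → ℝ) (i : ι) (d : ι → Bool) (b c : Bool) (l : L) :
    slice F i (update d i b) c l = slice F i d c l := by
  simp only [slice, update_mask_update]

omit [Fintype ι] in
lemma not_update (d : ι → Bool) (i : ι) (b : Bool) :
    (fun j => !(update d i b j)) = update (fun j => !d j) i (!b) := by
  ext j
  by_cases h : j = i
  · subst h; simp
  · simp [h]

omit [Fintype L] [DecidableEq L] in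
lemma slice_nonneg {F : L → (ι → Bool) → ℝ} (hF : ∀ l x, 0 ≤ F l x) (i : ι) (d : ι → Bool)
    (c : Bool) (l : L) : 0 ≤ slice F i d c l :=
  expect_nonneg fun _ _ => hF _ _

/-- The squared biases of the coordinate `i`, averaged over the leaves: given `d`, the coordinates
in `d` are random for the first player and zero for the second, and vice versa for the others. -/
noncomputable def leafBias (d : ι → Bool) (i : ι) : ℝ :=
  ∑ l, (𝔼 ω : (ι → Bool) × (ι → Bool), if g (mask d ω.1) (mask (fun j => !d j) ω.2) = l then
      (if d i = true then sgn (ω.1 i) else sgn (ω.2 i)) else 0) ^ 2 /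
    (𝔼 ω : (ι → Bool) × (ι → Bool),
      if g (mask d ω.1) (mask (fun j => !d j) ω.2) = l then (1 : ℝ) else 0)

lemma sum_leafBias_le (d : ι → Bool) :
    ∑ i, leafBias g d i ≤ 2 * log (Fintype.card L) :=
  sum_sq_div_le_log_card
    (fun i (ω : (ι → Bool) × (ι → Bool)) => if d i = true then sgn (ω.1 i) else sgn (ω.2 i))
    (expect_exp_sum_sgn_choice_le d) fun ω => g (mask d ω.1) (mask (fun j => !d j) ω.2)

variable {g A B}

/-- The leaf indicator is a product, so independent averages multiply. With `t = 1` this normalizes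
the leaf laws; general `t` yields the advantage. -/
lemma sum_mul_slice_mul_slice
    (hg : ∀ x y l, (if g x y = l then (1 : ℝ) else 0) = A l x * B l y)
    (t : L → ℝ) (i : ι) (d : ι → Bool) (c e : Bool) :
    ∑ l, t l * (slice A i d c l * slice B i (fun j => !d j) e l) =
      𝔼 u, 𝔼 v, t (g (update (mask d u) i c) (update (mask (fun j => !d j) v) i e)) := by
  have h : ∀ l, slice A i d c l * slice B i (fun j => !d j) e l = 𝔼 u, 𝔼 v,
      if g (update (mask d u) i c) (update (mask (fun j => !d j) v) i e) = l
        then (1 : ℝ) else 0 := by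
    intro l
    simp only [hg]
    exact Fintype.expect_mul_expect _ _
  simp only [h, mul_expect]
  rw [← expect_sum_comm]
  refine expect_congr rfl fun u _ => ?_
  rw [← expect_sum_comm]
  refine expect_congr rfl fun v _ => ?_
  simp

/-- The second player's bit at `i` is zero here, so the bias of the first player's bit compares the
leaf laws at (1,0) and (0,0). -/
lemma leafBias_of_mem (hA : ∀ l x, 0 ≤ A l x) (hB : ∀ l x, 0 ≤ B l x)
    (hg : ∀ x y l, (if g x y = l then (1 : ℝ) else 0) = A l x * B l y)
    (d : ι → Bool) (i : ι) (hi : d i = true) :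
    ∑ l, (√(slice A i d true l * slice B i (fun j => !d j) false l)
        - √(slice A i d false l * slice B i (fun j => !d j) false l)) ^ 2 / 2
      ≤ leafBias g d i := by
  refine sum_le_sum fun l _ => ?_
  have h1 : ∀ ω : (ι → Bool) × (ι → Bool),
      (if g (mask d ω.1) (mask (fun j => !d j) ω.2) = l then
        (if d i = true then sgn (ω.1 i) else sgn (ω.2 i)) else 0)
      = (sgn (ω.1 i) * A l (mask d ω.1)) * B l (mask (fun j => !d j) ω.2) := by
    intro ω
    rw [mul_assoc, ← hg]
    simp [hi]
  simp only [h1, hg]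
  rw [expect_prod_mul (fun u => sgn (u i) * A l (mask d u))
      (fun v => B l (mask (fun j => !d j) v)),
    expect_prod_mul (fun u => A l (mask d u)) (fun v => B l (mask (fun j => !d j) v)),
    expect_sgn_mul_mask_of_mem d i hi,
    expect_mask_of_mem d i hi,
    expect_mask_of_notMem (fun j => !d j) i (by simp [hi])]
  refine (sq_sqrt_sub_sqrt_le (mul_nonneg (slice_nonneg hA ..) (slice_nonneg hB ..))
    (mul_nonneg (slice_nonneg hA ..) (slice_nonneg hB ..))).trans (le_of_eq ?_)
  simp only [slice]
  congr 1
  · ring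
  · ring

lemma leafBias_of_notMem (hA : ∀ l x, 0 ≤ A l x) (hB : ∀ l x, 0 ≤ B l x)
    (hg : ∀ x y l, (if g x y = l then (1 : ℝ) else 0) = A l x * B l y)
    (d : ι → Bool) (i : ι) (hi : d i = false) :
    ∑ l, (√(slice A i d false l * slice B i (fun j => !d j) true l)
        - √(slice A i d false l * slice B i (fun j => !d j) false l)) ^ 2 / 2
      ≤ leafBias g d i := by
  refine sum_le_sum fun l _ => ?_
  have h1 : ∀ ω : (ι → Bool) × (ι → Bool),
      (if g (mask d ω.1) (mask (fun j => !d j) ω.2) = l then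
        (if d i = true then sgn (ω.1 i) else sgn (ω.2 i)) else 0)
      = A l (mask d ω.1) * (sgn (ω.2 i) * B l (mask (fun j => !d j) ω.2)) := by
    intro ω
    rw [mul_left_comm, ← hg]
    simp [hi]
  simp only [h1, hg]
  rw [expect_prod_mul (fun u => A l (mask d u))
      (fun v => sgn (v i) * B l (mask (fun j => !d j) v)),
    expect_prod_mul (fun u => A l (mask d u)) (fun v => B l (mask (fun j => !d j) v)),
    expect_mask_of_notMem d i hi,
    expect_sgn_mul_mask_of_mem (fun j => !d j) i (by simp [hi]),
    expect_mask_of_mem (fun j => !d j) i (by simp [hi])]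
  refine (sq_sqrt_sub_sqrt_le (mul_nonneg (slice_nonneg hA ..) (slice_nonneg hB ..))
    (mul_nonneg (slice_nonneg hA ..) (slice_nonneg hB ..))).trans (le_of_eq ?_)
  simp only [slice]
  congr 1
  · ring
  · ring

/-- How well the leaf test `t` tells apart inputs that are disjoint from inputs that meet in `i`. -/
noncomputable def advantage (g : (ι → Bool) → (ι → Bool) → L) (t : L → ℝ) (i : ι)
    (d : ι → Bool) : ℝ :=
  𝔼 u, 𝔼 v, (t (g (update (mask d u) i false) (update (mask (fun j => !d j) v) i false))
    - t (g (update (mask d u) i true) (update (mask (fun j => !d j) v) i true)))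

/-- Putting `i` on either side of the split bounds the distances from (0,0) to (1,0) and to (0,1);
the triangle inequality and cut-and-paste carry them to (0,0) against (1,1). -/
lemma sq_advantage_le_leafBias (hA : ∀ l x, 0 ≤ A l x) (hB : ∀ l x, 0 ≤ B l x)
    (hg : ∀ x y l, (if g x y = l then (1 : ℝ) else 0) = A l x * B l y)
    (t : L → ℝ) (ht : ∀ l, |t l| ≤ 1) (i : ι) (d : ι → Bool) :
    advantage g t i d ^ 2 / 16
      ≤ leafBias g (update d i true) i + leafBias g (update d i false) i := by
  have h1 := leafBias_of_mem hA hB hg (update d i true) i (by simp)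
  have h2 := leafBias_of_notMem hA hB hg (update d i false) i (by simp)
  simp only [not_update, slice_update] at h1 h2
  set a := slice A i d with ha
  set b := slice B i (fun j => !d j) with hb
  have ha0 : ∀ c l, 0 ≤ a c l := fun c l => slice_nonneg hA _ _ _ _
  have hb0 : ∀ c l, 0 ≤ b c l := fun c l => slice_nonneg hB _ _ _ _
  have hsum : ∀ c e, ∑ l, a c l * b e l = 1 := by
    intro c e
    simpa using sum_mul_slice_mul_slice hg (fun _ => 1) i d c e
  have hadv : advantage g t i d
      = ∑ l, t l * (a false l * b false l - a true l * b true l) := by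
    simp only [mul_sub, sum_sub_distrib, advantage, expect_sub_distrib]
    rw [sum_mul_slice_mul_slice hg, sum_mul_slice_mul_slice hg]
  have h3 := sq_sum_mul_sub_le _ _ t (fun l => mul_nonneg (ha0 false l) (hb0 false l))
    (fun l => mul_nonneg (ha0 true l) (hb0 true l)) (hsum _ _) (hsum _ _) ht
  rw [← hadv, sum_hellinger_cut_paste a b ha0 hb0 hsum] at h3
  -- Squared triangle inequality through (0,0): (α - β)² ≤ 2α² + 2β².
  have h4 : (∑ l, (√(a true l * b false l) - √(a false l * b true l)) ^ 2) / 4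
      ≤ leafBias g (update d i true) i + leafBias g (update d i false) i := by
    refine le_trans ?_ (add_le_add h1 h2)
    rw [← sum_add_distrib, sum_div]
    refine sum_le_sum fun l _ => ?_
    nlinarith [sq_nonneg ((√(a true l * b false l) - √(a false l * b false l))
      + (√(a false l * b true l) - √(a false l * b false l)))]
  linarith

/-- The information bound for disjointness: a partition of the inputs into rectangles on which
disjoint pairs and pairs that meet in one point are told apart has exponentially many parts. -/
theorem card_div_le_log_card [Nonempty ι] (hA : ∀ l x, 0 ≤ A l x) (hB : ∀ l x, 0 ≤ B l x)
    (hg : ∀ x y l, (if g x y = l then (1 : ℝ) else 0) = A l x * B l y)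
    (t : L → ℝ) (ht : ∀ l, |t l| ≤ 1) (hadv : 2 / 3 ≤ 𝔼 i, 𝔼 d, advantage g t i d) :
    (Fintype.card ι : ℝ) / 144 ≤ log (Fintype.card L) := by
  have h1 : 𝔼 d, ∑ i, leafBias g d i ≤ 2 * log (Fintype.card L) :=
    expect_le univ_nonempty fun d _ => sum_leafBias_le g d
  rw [expect_sum_comm, ← Fintype.card_mul_expect] at h1
  -- The square is replaced by its tangent at 2/3, so that only the mean advantage matters; 32 is 16
  -- times the 2 from resampling `d i`.
  have h2 : ∀ i, 𝔼 d, (advantage g t i d * (4 / 3) - 4 / 9) / 32 ≤ 𝔼 d, leafBias g d i := by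
    intro i
    rw [expect_eq_expect_update i (fun d => leafBias g d i), ← expect_add_distrib, expect_div]
    refine expect_le_expect fun d _ => ?_
    have := sq_advantage_le_leafBias hA hB hg t ht i d
    nlinarith [sq_nonneg (advantage g t i d - 2 / 3)]
  have h3 : 𝔼 i, 𝔼 d, (advantage g t i d * (4 / 3) - 4 / 9) / 32 ≤ 𝔼 i, 𝔼 d, leafBias g d i :=
    expect_le_expect fun i _ => h2 i
  simp only [← expect_div, expect_sub_distrib, ← expect_mul, Fintype.expect_const] at h3
  have h4 : (1 : ℝ) / 72 ≤ 𝔼 i, 𝔼 d, leafBias g d i := by linarith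
  have h5 := mul_le_mul_of_nonneg_left h4 (Nat.cast_nonneg (α := ℝ) (Fintype.card ι))
  linarith

end Core

end Disjointness

namespace Disjointness

open Finset Function Real
open scoped BigOperators

/-- `card_div_le_log_card` for a map all of whose fibres are combinatorial rectangles. -/
theorem card_div_le_log_card_of_rectangles {ι L : Type*} [Fintype ι] [DecidableEq ι] [Nonempty ι]
    [Fintype L] [DecidableEq L] (g : (ι → Bool) → (ι → Bool) → L)
    (hg : ∀ x y x' y', g x y = g x' y' → g x y' = g x y)
    (t : L → ℝ) (ht : ∀ l, |t l| ≤ 1) (hadv : 2 / 3 ≤ 𝔼 i, 𝔼 d, advantage g t i d) :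
    (Fintype.card ι : ℝ) / 144 ≤ log (Fintype.card L) := by
  classical
  -- A rectangular fibre is the product of its two projections.
  refine card_div_le_log_card (A := fun l x => if ∃ y, g x y = l then 1 else 0)
    (B := fun l y => if ∃ x, g x y = l then 1 else 0) (fun l x => ?_) (fun l x => ?_)
    (fun x y l => ?_) t ht hadv
  · positivity
  · positivity
  · have : g x y = l ↔ (∃ y', g x y' = l) ∧ ∃ x', g x' y = l := by
      refine ⟨fun h => ⟨⟨y, h⟩, ⟨x, h⟩⟩, ?_⟩
      rintro ⟨⟨y', h⟩, ⟨x', h'⟩⟩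
      rw [← h]
      exact hg _ _ _ _ (h.trans h'.symm)
    simp only [this, ite_and]
    split_ifs <;> simp

end Disjointness

/-! ### Transcripts of deterministic protocols. -/

namespace FairDivision

open Finset Function
open scoped BigOperators

namespace Protocol

variable {n : ℕ} {X O : Type}

/-- The bits sent, followed by the answer. -/
def transcript : Protocol n X Bool → (Fin n → X) → List Bool
  | declare i ans, x => [ans (x i)]
  | speak i msg next, x => msg (x i) :: transcript (next (msg (x i))) x

lemma length_transcript (P : Protocol n X Bool) (x : Fin n → X) :
    (P.transcript x).length = P.bits x + 1 := by
  induction P with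
  | declare i ans => rfl
  | speak i msg next ih => simp [transcript, bits, ih]

lemma answer_eq_of_transcript_eq (P : Protocol n X Bool) {x y : Fin n → X}
    (h : P.transcript x = P.transcript y) : P.answer x = P.answer y := by
  induction P with
  | declare i ans => simpa [transcript, answer] using h
  | speak i msg next ih =>
    simp only [transcript, List.cons.injEq] at h
    obtain ⟨h1, h2⟩ := h
    simp only [answer]
    rw [← h1] at h2 ⊢
    exact ih _ h2

/-- Each bit depends on one player's input, and with either of her two inputs she sends the same
bit. This is the rectangle property. -/
lemma transcript_mix (P : Protocol n X Bool) {x y z : Fin n → X}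
    (h : P.transcript x = P.transcript y) (hz : ∀ i, z i = x i ∨ z i = y i) :
    P.transcript z = P.transcript x := by
  induction P with
  | declare i ans =>
    simp only [transcript, List.cons.injEq, and_true] at h ⊢
    rcases hz i with hi | hi <;> simp [hi, h]
  | speak i msg next ih =>
    simp only [transcript, List.cons.injEq] at h ⊢
    obtain ⟨h1, h2⟩ := h
    have h3 : msg (z i) = msg (x i) := by rcases hz i with hi | hi <;> simp [hi, h1]
    rw [← h1] at h2
    exact ⟨h3, by rw [h3]; exact ih _ h2⟩

/-- The transcript, stored in `b + 1` cells. -/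
def leaf (P : Protocol n X Bool) (b : ℕ) (x : Fin n → X) : Fin (b + 1) → Option Bool :=
  -- Cells past the end hold `none`; the extra cell is for the answer.
  fun j => (P.transcript x)[(j : ℕ)]?

lemma transcript_eq_of_leaf_eq (P : Protocol n X Bool) {b : ℕ} {x y : Fin n → X}
    (hx : P.bits x ≤ b) (hy : P.bits y ≤ b) (h : P.leaf b x = P.leaf b y) :
    P.transcript x = P.transcript y := by
  refine List.ext_getElem? fun j => ?_
  by_cases hj : j < b + 1
  · exact congrFun h ⟨j, hj⟩
  · rw [List.getElem?_eq_none, List.getElem?_eq_none] <;> rw [length_transcript] <;> omega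

/-- The distributional lower bound for disjointness: a deterministic protocol that is right on
average about random disjoint and random uniquely meeting pairs sends linearly many bits. -/
theorem card_le_of_average_correct {ι : Type} [Fintype ι] [DecidableEq ι] [Nonempty ι]
    (P : Protocol 2 X Bool) (b : ℕ) (hb : ∀ x, P.bits x ≤ b) (V W : (ι → Bool) → X)
    (hP : 4 / 3 ≤ 𝔼 i : ι, 𝔼 d : ι → Bool, 𝔼 u : ι → Bool, 𝔼 v : ι → Bool,
      ((if P.answer ![V (update (Disjointness.mask d u) i false),
          W (update (Disjointness.mask (fun j => !d j) v) i false)] = false then (1 : ℝ) else 0)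
        + (if P.answer ![V (update (Disjointness.mask d u) i true),
          W (update (Disjointness.mask (fun j => !d j) v) i true)] = true
            then (1 : ℝ) else 0))) :
    (Fintype.card ι : ℝ) ≤ 288 * (b + 1) := by
  classical
  set g : (ι → Bool) → (ι → Bool) → (Fin (b + 1) → Option Bool) :=
    fun x y => P.leaf b ![V x, W y] with hg
  set t : (Fin (b + 1) → Option Bool) → ℝ :=
    fun l => if ∃ x, P.leaf b x = l ∧ P.answer x = true then -1 else 1 with ht
  have htg : ∀ x y, t (g x y) = if P.answer ![V x, W y] = true then -1 else 1 := by
    intro x y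
    have : (∃ z, P.leaf b z = g x y ∧ P.answer z = true) ↔ P.answer ![V x, W y] = true := by
      constructor
      · rintro ⟨z, h1, h2⟩
        rw [← h2]
        exact (P.answer_eq_of_transcript_eq
          (P.transcript_eq_of_leaf_eq (hb _) (hb _) h1)).symm
      · exact fun h => ⟨_, rfl, h⟩
    simp only [ht, this]
  have h := Disjointness.card_div_le_log_card_of_rectangles g ?_ t ?_ ?_
  -- Each cell has three states, and 288 = 144 * 2.
  · have h3 : Real.log 3 ≤ 2 := by
      have := Real.log_le_sub_one_of_pos (show (0 : ℝ) < 3 by norm_num)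
      linarith
    have hcard : Real.log (Fintype.card (Fin (b + 1) → Option Bool)) = (b + 1) * Real.log 3 := by
      simp
    rw [hcard] at h
    have : ((b : ℝ) + 1) * Real.log 3 ≤ (b + 1) * 2 := by gcongr
    linarith
  · intro x y x' y' hxy
    have h1 := P.transcript_eq_of_leaf_eq (hb _) (hb _) hxy
    have h2 := P.transcript_mix (z := ![V x, W y']) h1 (by
      intro i
      fin_cases i <;> simp)
    funext j
    simp only [hg, leaf, h2]
  · intro l
    simp only [ht]
    split_ifs <;> simp
  -- Success 4/3 becomes advantage 2 * (4/3) - 2 = 2/3.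
  · have : ∀ i d, Disjointness.advantage g t i d = 2 * (𝔼 u : ι → Bool, 𝔼 v : ι → Bool,
      ((if P.answer ![V (update (Disjointness.mask d u) i false),
          W (update (Disjointness.mask (fun j => !d j) v) i false)] = false then (1 : ℝ) else 0)
        + (if P.answer ![V (update (Disjointness.mask d u) i true),
          W (update (Disjointness.mask (fun j => !d j) v) i true)] = true
            then (1 : ℝ) else 0))) - 2 := by
      intro i d
      rw [mul_expect, ← Fintype.expect_const (ι := ι → Bool) (2 : ℝ), ← expect_sub_distrib]
      refine expect_congr rfl fun u _ => ?_
      rw [Fintype.expect_const, mul_expect, ← Fintype.expect_const (ι := ι → Bool) (2 : ℝ),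
        ← expect_sub_distrib]
      refine expect_congr rfl fun v _ => ?_
      rw [Fintype.expect_const, htg, htg]
      cases P.answer ![V (update (Disjointness.mask d u) i false),
          W (update (Disjointness.mask (fun j => !d j) v) i false)] <;>
      cases P.answer ![V (update (Disjointness.mask d u) i true),
          W (update (Disjointness.mask (fun j => !d j) v) i true)] <;> norm_num
    simp only [this, expect_sub_distrib, ← mul_expect, Fintype.expect_const]
    linarith

/-- Changing the answers of a protocol by a function of the answer. -/
def map {O' : Type} (f : O → O') : Protocol n X O → Protocol n X O'
  | declare i ans => declare i fun x => f (ans x)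
  | speak i msg next => speak i msg fun b => map f (next b)

@[simp] lemma answer_map {O' : Type} (f : O → O') (P : Protocol n X O) (x : Fin n → X) :
    (P.map f).answer x = f (P.answer x) := by
  induction P with
  | declare i ans => rfl
  | speak i msg next ih => simp [map, answer, ih]

@[simp] lemma bits_map {O' : Type} (f : O → O') (P : Protocol n X O) (x : Fin n → X) :
    (P.map f).bits x = P.bits x := by
  induction P with
  | declare i ans => rfl
  | speak i msg next ih => simp [map, bits, ih]

end Protocol

instance (n : ℕ) : IsProbabilityMeasure (coinMeasure n) := by
  unfold coinMeasure
  infer_instance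

/-! ### Fixing the coins, and passing from search to decision. -/

namespace RandomizedProtocol

variable {n : ℕ} {X O : Type}

lemma bits_le_cost (Γ : RandomizedProtocol n X O) (ω : Coins n) (x : Fin n → X) :
    (((Γ.run ω).bits x : ℕ) : ℕ∞) ≤ Γ.cost :=
  le_iSup₂ (f := fun (x : Fin n → X) (ω : Coins n) => (((Γ.run ω).bits x : ℕ) : ℕ∞)) x ω

/-- Some outcome of the coins is right on two thirds of any finite family of inputs. -/
lemma Computes.exists_run [Countable O] {Γ : RandomizedProtocol n X O}
    {right : (Fin n → X) → O → Prop} (h : Γ.Computes right) {J : Type} [Fintype J] [Nonempty J]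
    (x : J → Fin n → X) [∀ j o, Decidable (right (x j) o)] :
    ∃ ω, 2 / 3 ≤ 𝔼 j, (if right (x j) ((Γ.run ω).answer (x j)) then (1 : ℝ) else 0) := by
  set C : J → Set (Coins n) := fun j => {ω | right (x j) ((Γ.run ω).answer (x j))} with hC
  have hmeas : ∀ j, MeasurableSet (C j) := by
    intro j
    -- Only single answers are known to be measurable events; countably many answers suffice.
    have : C j = ⋃ o ∈ {o | right (x j) o}, {ω | (Γ.run ω).answer (x j) = o} := by
      ext ω
      simp [hC]
    rw [this]
    exact MeasurableSet.biUnion (Set.to_countable _) fun o _ => Γ.measurableSet_answer _ _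
  have hint : ∫⁻ ω, ∑ j, (C j).indicator 1 ω ∂coinMeasure n = ∑ j, coinMeasure n (C j) := by
    rw [lintegral_finsetSum _ fun j _ => measurable_one.indicator (hmeas j)]
    exact sum_congr rfl fun j _ => lintegral_indicator_one (hmeas j)
  have hfin : ∫⁻ ω, ∑ j, (C j).indicator 1 ω ∂coinMeasure n ≠ ∞ := by
    rw [hint]
    exact (ENNReal.sum_lt_top.2 fun j _ => measure_lt_top _ _).ne
  obtain ⟨ω, hω⟩ := exists_lintegral_le hfin
  refine ⟨ω, ?_⟩
  rw [hint] at hω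
  have h1 : (Fintype.card J : ℝ≥0∞) * (2 / 3) ≤ ∑ j, (C j).indicator 1 ω := by
    refine le_trans ?_ hω
    rw [← nsmul_eq_mul, ← card_univ]
    exact card_nsmul_le_sum _ _ _ fun j _ => h (x j)
  have h2 : (∑ j, (C j).indicator (1 : Coins n → ℝ≥0∞) ω)
      = ENNReal.ofReal (∑ j, (if right (x j) ((Γ.run ω).answer (x j)) then (1 : ℝ) else 0)) := by
    rw [ENNReal.ofReal_sum_of_nonneg fun j _ => by positivity]
    refine sum_congr rfl fun j _ => ?_
    by_cases hj : right (x j) ((Γ.run ω).answer (x j)) <;> simp [hC, hj]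
  have h3 : (Fintype.card J : ℝ≥0∞) * (2 / 3)
      = ENNReal.ofReal (Fintype.card J * (2 / 3)) := by
    rw [ENNReal.ofReal_mul (by positivity), ENNReal.ofReal_natCast,
      ENNReal.ofReal_div_of_pos (by norm_num)]
    simp
  rw [h2, h3, ENNReal.ofReal_le_ofReal_iff (sum_nonneg fun j _ => by positivity)] at h1
  rw [Fintype.expect_eq_sum_div_card, le_div_iff₀ (by exact_mod_cast Fintype.card_pos)]
  linarith

/-- The decision protocol that answers whether a search protocol finds a solution. -/
def toDecision (Γ : RandomizedProtocol n X (Option O)) : RandomizedProtocol n X Bool where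
  run ω := (Γ.run ω).map Option.isSome
  measurableSet_answer x o := by
    have h := Γ.measurableSet_answer x none
    cases o
    · convert h using 1
      ext ω
      simp
    · convert h.compl using 1
      ext ω
      simp [Option.isSome_iff_ne_none]

lemma cost_toDecision (Γ : RandomizedProtocol n X (Option O)) : Γ.toDecision.cost = Γ.cost := by
  simp [cost, toDecision]

lemma Computes.toDecision {m : ℕ} {D : Set ℝ≥0} {c : ℝ}
    {Γ : RandomizedProtocol n (Valuation m D) (Option (Allocation n m))}
    (h : Γ.Computes (RightSearch c)) : Γ.toDecision.Computes (RightDecision c) := by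
  intro x
  refine (h x).trans (measure_mono fun ω hω => ?_)
  simp only [Set.mem_ofPred_eq, RandomizedProtocol.toDecision, Protocol.answer_map] at hω ⊢
  cases hA : (Γ.run ω).answer x with
  | none =>
    rw [hA] at hω
    simpa [RightDecision, RightSearch] using hω
  | some A =>
    rw [hA] at hω
    simpa [RightDecision] using ⟨A, hω⟩

end RandomizedProtocol

end FairDivision

/-! ### Disjointness as a question about allocations. -/

namespace FairDivision

open Finset Function
open scoped BigOperators

/-- The `0`-`1` valuation that values the bundles of more than `k` items and those bundles of
exactly `k` items that satisfy `F`. -/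
noncomputable def middleValuation {D : Set ℝ≥0} (h0 : 0 ∈ D) (h1 : 1 ∈ D) {k : ℕ} (hk : 1 ≤ k)
    (F : Finset (Fin (2 * k)) → Prop) : Valuation (2 * k) D where
  val S := by classical exact if k < S.card ∨ (S.card = k ∧ F S) then 1 else 0
  mono S T hST := by
    have hle := card_le_card hST
    split_ifs with hS hT
    · exact le_rfl
    · refine absurd ?_ hT
      rcases hS with hS | ⟨hS, hF⟩
      · exact Or.inl (by omega)
      · rcases hle.eq_or_lt with h | h
        · exact Or.inr ⟨by omega, eq_of_subset_of_card_le hST h.ge ▸ hF⟩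
        · exact Or.inl (by omega)
    · exact zero_le
    · exact le_rfl
  val_empty := by
    rw [if_neg]
    simp
    omega
  val_univ_pos := by
    rw [if_pos]
    · exact one_pos
    · simp
      omega
  mem_values S := by
    split_ifs <;> assumption

section Reduction

variable {D : Set ℝ≥0} (h0 : 0 ∈ D) (h1 : 1 ∈ D) {k : ℕ} (hk : 1 ≤ k)

/-- The bundles of half of the items. -/
abbrev HalfBundle (k : ℕ) : Type := {S : Finset (Fin (2 * k)) // S.card = k}

/-- The first player values the half bundles in the family `x`. -/
noncomputable def firstValuation (x : HalfBundle k → Bool) : Valuation (2 * k) D :=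
  middleValuation h0 h1 hk fun S => ∃ h : S.card = k, x ⟨S, h⟩ = true

/-- The second player values the complements of the half bundles in the family `y`. -/
noncomputable def secondValuation (y : HalfBundle k → Bool) : Valuation (2 * k) D :=
  middleValuation h0 h1 hk fun S => ∃ h : Sᶜ.card = k, y ⟨Sᶜ, h⟩ = true

/-- The threshold c/2 lies strictly between the values 0 and 1, or below 1 at least; so `c` plays no
further role. -/
lemma le_middleValuation_iff {c : ℝ} (hc0 : 0 < c) (hc1 : c ≤ 1)
    (F : Finset (Fin (2 * k)) → Prop) (S : Finset (Fin (2 * k))) :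
    c * (((middleValuation h0 h1 hk F).val univ : ℝ) / ((2 : ℕ) : ℝ))
        ≤ ((middleValuation h0 h1 hk F).val S : ℝ) ↔ k < S.card ∨ (S.card = k ∧ F S) := by
  have hu : (middleValuation h0 h1 hk F).val univ = 1 := if_pos (Or.inl (by simp; omega))
  rw [hu]
  by_cases hS : k < S.card ∨ (S.card = k ∧ F S)
  · have h : (middleValuation h0 h1 hk F).val S = 1 := if_pos hS
    rw [h]
    simp only [hS, iff_true]
    push_cast
    linarith
  · have h : (middleValuation h0 h1 hk F).val S = 0 := if_neg hS
    rw [h]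
    simp only [hS, iff_false, not_le]
    push_cast
    linarith

/-- The two bundles are complementary in 2k items, so if neither has fewer than k, both have exactly
k. -/
lemma exists_isProp_iff {c : ℝ} (hc0 : 0 < c) (hc1 : c ≤ 1) (x y : HalfBundle k → Bool) :
    (∃ A, IsProp c ![firstValuation h0 h1 hk x, secondValuation h0 h1 hk y] A)
      ↔ ∃ S, x S = true ∧ y S = true := by
  have hcompl : ∀ A : Allocation 2 (2 * k), A.bundle 1 = (A.bundle 0)ᶜ := by
    intro A
    ext j
    simp only [Allocation.bundle, mem_filter, mem_univ, true_and, mem_compl]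
    omega
  have hprop : ∀ A, IsProp c ![firstValuation h0 h1 hk x, secondValuation h0 h1 hk y] A ↔
      (k < (A.bundle 0).card ∨ ((A.bundle 0).card = k ∧
        ∃ h : (A.bundle 0).card = k, x ⟨A.bundle 0, h⟩ = true)) ∧
      (k < (A.bundle 0)ᶜ.card ∨ ((A.bundle 0)ᶜ.card = k ∧
        ∃ h : (A.bundle 0)ᶜᶜ.card = k, y ⟨(A.bundle 0)ᶜᶜ, h⟩ = true)) := by
    intro A
    rw [IsProp, Fin.forall_fin_two, ← hcompl A]
    exact and_congr (le_middleValuation_iff h0 h1 hk hc0 hc1 _ _)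
      (le_middleValuation_iff h0 h1 hk hc0 hc1 _ _)
  constructor
  · rintro ⟨A, hA⟩
    rw [hprop] at hA
    simp only [compl_compl] at hA
    have hcard := card_add_card_compl (A.bundle 0)
    rw [Fintype.card_fin] at hcard
    obtain ⟨hA1 | ⟨-, hS, hx⟩, hA2 | ⟨-, hS', hy⟩⟩ := hA
    · omega
    · omega
    · omega
    · exact ⟨⟨A.bundle 0, hS⟩, hx, hy⟩
  · rintro ⟨⟨S, hS⟩, hx, hy⟩
    have hb : Allocation.bundle (fun j => if j ∈ S then 0 else 1 : Allocation 2 (2 * k)) 0 = S := by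
      ext j
      simp [Allocation.bundle]
    refine ⟨fun j => if j ∈ S then 0 else 1, (hprop _).2 ?_⟩
    have hcard := card_add_card_compl S
    rw [Fintype.card_fin] at hcard
    rw [hb]
    simp only [compl_compl]
    exact ⟨Or.inr ⟨hS, hS, hx⟩, Or.inr ⟨by omega, hS, hy⟩⟩

end Reduction

/-! ### The communication bounds. -/

variable {D : Set ℝ≥0} {k : ℕ}

/-- A protocol that decides whether there is a `c`-Prop allocation sends linearly many bits in
the number of half bundles, up to an additive constant. -/
lemma choose_le_of_computes {c : ℝ} (hc0 : 0 < c) (hc1 : c ≤ 1) (h0 : 0 ∈ D) (h1 : 1 ∈ D)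
    (hk : 1 ≤ k) {Γ : RandomizedProtocol 2 (Valuation (2 * k) D) Bool}
    (hΓ : Γ.Computes (RightDecision c)) {b : ℕ} (hb : Γ.cost ≤ b) :
    ((2 * k).choose k : ℝ) ≤ 288 * (b + 1) := by
  classical
  have hcard : Fintype.card (HalfBundle k) = (2 * k).choose k := by
    simp
  have : Nonempty (HalfBundle k) := by
    rw [← Fintype.card_pos_iff, hcard]
    exact Nat.choose_pos (by omega)
  let Cube := HalfBundle k → Bool
  let x : HalfBundle k × Cube × Cube × Cube × Bool → Profile 2 (2 * k) D :=
    fun ⟨i, d, u, v, e⟩ => ![firstValuation h0 h1 hk (update (Disjointness.mask d u) i e),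
      secondValuation h0 h1 hk (update (Disjointness.mask (fun j => !d j) v) i e)]
  have hx : ∀ i d u v e a, RightDecision c (x (i, d, u, v, e)) a ↔ a = e := by
    intro i d u v e a
    rw [RightDecision, exists_isProp_iff h0 h1 hk hc0 hc1]
    -- Off `i` the masks have disjoint supports, so only `i` can be common.
    have hmeet : (∃ S, update (Disjointness.mask d u) i e S = true ∧
        update (Disjointness.mask (fun j => !d j) v) i e S = true) ↔ e = true := by
      constructor
      · rintro ⟨S, hS1, hS2⟩
        by_cases h : S = i
        · subst h; simpa using hS1
        · simp only [update_of_ne h, Disjointness.mask, Bool.and_eq_true,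
            Bool.not_eq_true'] at hS1 hS2
          simp [hS1.1] at hS2
      · rintro rfl
        exact ⟨i, by simp⟩
    rw [hmeet]
    cases a <;> cases e <;> simp
  obtain ⟨ω, hω⟩ := hΓ.exists_run x
  have hbits : ∀ z, (Γ.run ω).bits z ≤ b := fun z =>
    by exact_mod_cast (Γ.bits_le_cost ω z).trans hb
  rw [← hcard]
  refine Protocol.card_le_of_average_correct (Γ.run ω) b hbits (firstValuation h0 h1 hk)
    (secondValuation h0 h1 hk) ?_
  simp only [← univ_product_univ, expect_product, hx] at hω
  have hbool : ∀ f : Bool → ℝ, 𝔼 e, f e = (f false + f true) / 2 := by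
    intro f
    rw [Fintype.expect_eq_sum_div_card, Fintype.sum_bool, Fintype.card_bool, add_comm]
    norm_num
  simp only [hbool, ← expect_div] at hω
  change 2 / 3 ≤ _ / _ at hω
  rw [le_div_iff₀ two_pos] at hω
  refine le_trans (by norm_num) hω

/-- A protocol that decides whether there is a `c`-Prop allocation sends at least one bit. -/
lemma cost_ne_zero_of_computes {c : ℝ} (hc0 : 0 < c) (hc1 : c ≤ 1) (h0 : 0 ∈ D) (h1 : 1 ∈ D)
    (hk : 1 ≤ k) {Γ : RandomizedProtocol 2 (Valuation (2 * k) D) Bool}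
    (hΓ : Γ.Computes (RightDecision c)) : Γ.cost ≠ 0 := by
  classical
  intro hcost
  have hcard : Fintype.card (HalfBundle k) = (2 * k).choose k := by
    simp
  have h2 : 1 < Fintype.card (HalfBundle k) := by
    rw [hcard, ← Nat.centralBinom_eq_two_mul_choose]
    exact Nat.lt_of_lt_of_le one_lt_two (Nat.two_le_centralBinom k hk)
  obtain ⟨S, T, hST⟩ := Fintype.one_lt_card_iff.1 h2
  -- Two singleton families meet iff they are equal. A silent protocol's answer ignores one of the
  -- two players, so it is right on only half of the four inputs, less than 2/3.
  let s : Bool → HalfBundle k → Bool := fun p U => decide (U = bif p then S else T)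
  let x : Bool × Bool → Profile 2 (2 * k) D :=
    fun p => ![firstValuation h0 h1 hk (s p.1), secondValuation h0 h1 hk (s p.2)]
  have hx : ∀ p q a, RightDecision c (x (p, q)) a ↔ a = decide (p = q) := by
    intro p q a
    rw [RightDecision, exists_isProp_iff h0 h1 hk hc0 hc1]
    cases p <;> cases q <;> cases a <;> simp [s, hST, hST.symm]
  obtain ⟨ω, hω⟩ := hΓ.exists_run x
  have hbits : ∀ z, (Γ.run ω).bits z = 0 := fun z => by
    have := Γ.bits_le_cost ω z
    rw [hcost] at this
    simpa using this
  simp only [← univ_product_univ, expect_product, hx] at hω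
  have hbool : ∀ f : Bool → ℝ, 𝔼 e, f e = (f false + f true) / 2 := by
    intro f
    rw [Fintype.expect_eq_sum_div_card, Fintype.sum_bool, Fintype.card_bool, add_comm]
    norm_num
  simp only [hbool] at hω
  revert hω hbits
  cases Γ.run ω with
  | speak i msg next =>
    intro hbits
    exact absurd (hbits (x (true, true))) (by simp [Protocol.bits])
  | declare i ans =>
    intro _
    simp only [Protocol.answer, x]
    fin_cases i
    · generalize hp : ans (firstValuation h0 h1 hk (s false)) = p
      generalize hq : ans (firstValuation h0 h1 hk (s true)) = q
      cases p <;> cases q <;> norm_num [hp, hq]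
    · generalize hp : ans (secondValuation h0 h1 hk (s false)) = p
      generalize hq : ans (secondValuation h0 h1 hk (s true)) = q
      cases p <;> cases q <;> norm_num [hp, hq]

/-- At least one bit is sent, so b + 1 ≤ 2b absorbs the additive constant, and 576 = 2 * 288. -/
lemma mul_choose_le_cost {c : ℝ} (hc0 : 0 < c) (hc1 : c ≤ 1) (h0 : 0 ∈ D) (h1 : 1 ∈ D)
    (hk : 1 ≤ k) {Γ : RandomizedProtocol 2 (Valuation (2 * k) D) Bool}
    (hΓ : Γ.Computes (RightDecision c)) :
    ((1 / 576 : ℝ≥0) : ℝ≥0∞) * ((2 * k).choose k : ℝ≥0∞) ≤ (Γ.cost : ℝ≥0∞) := by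
  have hne := cost_ne_zero_of_computes hc0 hc1 h0 h1 hk hΓ
  cases hcost : Γ.cost with
  | top => simp
  | coe b =>
    have h := choose_le_of_computes hc0 hc1 h0 h1 hk hΓ hcost.le
    have hb : (1 : ℝ) ≤ b := by
      rw [hcost] at hne
      exact_mod_cast Nat.one_le_iff_ne_zero.2 (by exact_mod_cast hne)
    have h' : (1 / 576 : ℝ≥0) * ((2 * k).choose k : ℝ≥0) ≤ (b : ℝ≥0) := by
      rw [← NNReal.coe_le_coe]
      push_cast
      linarith
    rw [ENat.toENNReal_coe]
    exact_mod_cast h'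

end FairDivision

theorem mainTheorem10 :
    ∃ δ : ℝ≥0, 0 < δ ∧
      ∀ (c : ℝ) (k : ℕ) (D : Set ℝ≥0), 0 < c → c ≤ 1 → 1 ≤ k → 0 ∈ D → 1 ∈ D →
        (∀ Γ : FairDivision.RandomizedProtocol 2 (FairDivision.Valuation (2 * k) D) Bool,
          Γ.Computes (FairDivision.RightDecision c) →
            (δ : ℝ≥0∞) * (Nat.choose (2 * k) k : ℝ≥0∞) ≤ (Γ.cost : ℝ≥0∞)) ∧
        (δ : ℝ≥0∞) * (Nat.choose (2 * k) k : ℝ≥0∞) ≤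
          (FairDivision.randomizedComplexity D 2 (2 * k) c : ℝ≥0∞) := by
  refine ⟨1 / 576, by norm_num, fun c k D hc0 hc1 hk h0 h1 => ⟨fun Γ hΓ =>
    FairDivision.mul_choose_le_cost hc0 hc1 h0 h1 hk hΓ, ?_⟩⟩
  rw [FairDivision.randomizedComplexity]
  simp only [ENat.toENNReal_iInf]
  refine le_iInf₂ fun Γ hΓ => ?_
  rw [← Γ.cost_toDecision]
  exact FairDivision.mul_choose_le_cost hc0 hc1 h0 h1 hk hΓ.toDecision
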